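/- Let $N\ge 1$, let $\Omega\subset\mathbb{R}^N$ be a bounded domain (non-empty, open, connected) with boundary of class $C^2$, and let $\sigma\in(0,1)$ and $p\in[1,\infty)$ satisfy $\sigma p\ge 1$. Let $g\in C^0(\partial\Omega)$ and $h\in L^\infty(\mathbb{R}^N\setminus\overline\Omega)$ be such that $g\not\le 0$ on $\partial\Omega$ (that is, $g(x)>0$ for some $x\in\partial\Omega$) and $h\le 0$ almost everywhere in $\mathbb{R}^N\setminus\overline\Omega$. Then the problem $$ \left\{\begin{aligned} -\Delta u+\big|(-\Delta)^\sigma u\big|^{p-1}(-\Delta)^\sigma u&=0 &&\text{in }\Omega,\\ u&=g &&\text{on }\partial\Omega,\\ u&=h &&\text{a.e. in }\mathbb{R}^N\setminus\overline\Omega \end{aligned}\right. $$ has no solution $u\in L^\infty(\mathbb{R}^N)\cap C^2(\Omega)\cap C^0(\overline\Omega)$, where the first two lines are understood pointwise. Here $$(-\Delta)^\sigma u(x)=c_{N,\sigma}\lim_{\varepsilon\downarrow0}\int_{\mathbb{R}^N\setminus B_\varepsilon(x)}\frac{u(x)-u(y)}{|x-y|^{N+2\sigma}}\,dy,\qquad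 c_{N,\sigma}=\frac{4^\sigma\,\sigma\,\Gamma(N/2+\sigma)}{\pi^{N/2}\,\Gamma(1-\sigma)},$$ is the fractional Laplacian, normalized so that its Fourier symbol is $|\xi|^{2\sigma}$. -/

import Mathlib

open MeasureTheory Filter Topology

/-- The normalization constant of the fractional Laplacian on `ℝᴺ`,
`c_{N,σ} = 4 ^ σ σ Γ(N/2 + σ) / (π ^ (N/2) Γ(1 - σ))`: the positive constant for which the
operator `fracLaplacian` below has Fourier symbol `|ξ| ^ (2σ)`. -/
noncomputable def fracLaplacianConst (N : ℕ) (σ : ℝ) : ℝ :=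
  (4 : ℝ) ^ σ * σ * Real.Gamma ((N : ℝ) / 2 + σ) /
    (Real.pi ^ ((N : ℝ) / 2) * Real.Gamma (1 - σ))

/-- The truncated singular integral
`c_{N,σ} ∫_{ℝᴺ ∖ B_ε(x)} (u(x) - u(y)) / |x - y| ^ (N + 2σ) dy`. -/
noncomputable def fracLaplacianTrunc {N : ℕ} (σ : ℝ) (u : EuclideanSpace ℝ (Fin N) → ℝ)
    (x : EuclideanSpace ℝ (Fin N)) (ε : ℝ) : ℝ :=
  fracLaplacianConst N σ *
    ∫ y in (Metric.ball x ε)ᶜ, (u x - u y) / ‖x - y‖ ^ ((N : ℝ) + 2 * σ)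

/-- The fractional Laplacian `(-Δ)^σ u(x)`, as the principal value (limit as `ε ↓ 0`) of the
truncated singular integrals. The limit exists whenever `u` is bounded and measurable and is `C²`
in a neighbourhood of `x`, and `0 < σ < 1`. -/
noncomputable def fracLaplacian {N : ℕ} (σ : ℝ) (u : EuclideanSpace ℝ (Fin N) → ℝ)
    (x : EuclideanSpace ℝ (Fin N)) : ℝ :=
  limUnder (𝓝[>] (0 : ℝ)) (fracLaplacianTrunc σ u x)

/-- The set `Ω` has boundary of class `C²`: near each boundary point, `Ω` is the
negativity set of a `C²` function with non-vanishing gradient at that point. -/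
def HasC2Boundary {N : ℕ} (Ω : Set (EuclideanSpace ℝ (Fin N))) : Prop :=
  ∀ x₀ ∈ frontier Ω, ∃ (U : Set (EuclideanSpace ℝ (Fin N))) (ρ : EuclideanSpace ℝ (Fin N) → ℝ),
    IsOpen U ∧ x₀ ∈ U ∧ ContDiffOn ℝ 2 ρ U ∧ fderiv ℝ ρ x₀ ≠ 0 ∧
      Ω ∩ U = {x ∈ U | ρ x < 0}

/-- A bounded domain (non-empty, open, connected) with boundary of class `C²`. -/
structure IsBoundedC2Domain {N : ℕ} (Ω : Set (EuclideanSpace ℝ (Fin N))) : Prop where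
  isOpen : IsOpen Ω
  isConnected : IsConnected Ω
  isBounded : Bornology.IsBounded Ω
  c2_boundary : HasC2Boundary Ω

/-- `u ∈ L^∞(ℝᴺ) ∩ C²(Ω) ∩ C⁰(Ω̄)` solves
`-Δu + |(-Δ)^σ u|^(p-1) (-Δ)^σ u = f` in `Ω`, `u = g` on `∂Ω`, `u = h` in `ℝᴺ ∖ Ω̄`
(the first two pointwise, the last one almost everywhere, as `h` is an `L^∞` datum). -/
structure IsSolution {N : ℕ} (σ p : ℝ) (Ω : Set (EuclideanSpace ℝ (Fin N)))
    (f g h : EuclideanSpace ℝ (Fin N) → ℝ) (u : EuclideanSpace ℝ (Fin N) → ℝ) : Prop where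
  memLp_top : MemLp u ⊤ volume
  contDiffOn : ContDiffOn ℝ 2 u Ω
  continuousOn : ContinuousOn u (closure Ω)
  equation : ∀ x ∈ Ω,
    -Laplacian.laplacian u x + |fracLaplacian σ u x| ^ (p - 1) * fracLaplacian σ u x = f x
  boundary : ∀ x ∈ frontier Ω, u x = g x
  exterior : ∀ᵐ x ∂(volume.restrict (closure Ω)ᶜ), u x = h x

/-! A solution `u` has a positive maximum `M` over `closure Ω`, while `u ≤ 0` a.e. outside. The
contradiction comes from a scaling principle, `exists_threshold_equation_ne_zero`. Suppose `u` is
touched from above at `x ∈ Ω` by a quadratic of opening `Q` on a ball of radius `r ≤ 1`, is almost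
maximal at `x`, and is lower by a fixed amount on a ball of radius `r` at distance comparable to
`r`. Then `(-Δ)^σ u(x) ≥ m₀ r^(-2σ)`, so its `p`-th power is at least `m₀^p r^(-2)` because `σp ≥
1`, whereas `Δu(x) ≤ 2NQ`. If `Q r²` is small, the equation fails at `x`.

At an interior maximum, `Q = 0` works. If the maximum is at `x₀ ∈ ∂Ω`, maximize `u - |· - x₀|² + ε
log(-ρ)` instead, with `ρ` a local defining function. The logarithm keeps the maximizer `x` inside
`Ω`. On a ball of radius comparable to `w = -ρ(x)`, its second-order contribution is `O(ε / w²)`, so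
`Q r²` stays small however close `x` is to `∂Ω`. The `C²` boundary supplies the exterior ball at the
same scale. -/

/-! ### Taylor bounds and second-order tests at touching points. -/

/-- The derivative is Lipschitz near `x₀`, so the mean value inequality gives a constant uniform in
the base point `x`. This uniformity matters for `ρ`, which is expanded at points approaching the
boundary. -/
theorem ContDiffAt.exists_abs_sub_sub_fderiv_le {E : Type*} [NormedAddCommGroup E]
    [NormedSpace ℝ E] {f : E → ℝ} {x₀ : E} (hf : ContDiffAt ℝ 2 f x₀) :
    ∃ r > 0, ∃ C ≥ 0, ∀ x ∈ Metric.ball x₀ r, ∀ y ∈ Metric.ball x₀ r,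
      |f y - f x - fderiv ℝ f x (y - x)| ≤ C * ‖y - x‖ ^ 2 := by
  have h1 : ContDiffAt ℝ 1 (fderiv ℝ f) x₀ := hf.fderiv_right (by norm_num)
  obtain ⟨K, t, ht, hK⟩ := h1.exists_lipschitzOnWith
  have h2 : ∀ᶠ y in 𝓝 x₀, DifferentiableAt ℝ f y :=
    (hf.eventually (by simp)).mono fun y hy => hy.differentiableAt (by norm_num)
  obtain ⟨r, hr, hsub⟩ := Metric.mem_nhds_iff.1 (Filter.inter_mem ht h2)
  refine ⟨r, hr, K, K.2, fun x hx y hy => ?_⟩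
  -- Intersecting with the closed ball bounds the variation of the derivative by `K * ‖y - x‖`,
  -- which yields the square.
  have hconv : Convex ℝ (Metric.ball x₀ r ∩ Metric.closedBall x ‖y - x‖) :=
    (convex_ball _ _).inter (convex_closedBall _ _)
  have key := hconv.norm_image_sub_le_of_norm_hasFDerivWithin_le' (f := f)
    (f' := fderiv ℝ f) (φ := fderiv ℝ f x) (C := K * ‖y - x‖) (x := x) (y := y)
    (fun z hz => (hsub hz.1).2.hasFDerivAt.hasFDerivWithinAt)
    (fun z hz => by
      have := hK.dist_le_mul z (hsub hz.1).1 x (hsub hx).1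
      rw [dist_eq_norm] at this
      refine this.trans ?_
      gcongr
      exact hz.2)
    ⟨hx, Metric.mem_closedBall_self (norm_nonneg _)⟩
    ⟨hy, by simp [dist_eq_norm]⟩
  rw [Real.norm_eq_abs] at key
  calc _ ≤ _ := key
    _ = _ := by ring

/-- A positive second derivative would make `a` a local minimum too, so `f` would be locally
constant and the second derivative zero. -/
theorem deriv_deriv_nonpos_of_isLocalMax {f : ℝ → ℝ} {a : ℝ} (hf : ContinuousAt f a)
    (h : IsLocalMax f a) : deriv (deriv f) a ≤ 0 := by
  by_contra! hpos
  have hmin := isLocalMin_of_deriv_deriv_pos hpos h.deriv_eq_zero hf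
  have hconst : f =ᶠ[𝓝 a] fun _ => f a := by
    filter_upwards [h, hmin] with y h1 h2 using le_antisymm h1 h2
  have : deriv (deriv f) a = 0 := by
    rw [(hconst.deriv).deriv_eq]; simp
  linarith

section touching

variable {E : Type*} [NormedAddCommGroup E] [InnerProductSpace ℝ E]
  {u : E → ℝ} {x : E} {l : E →L[ℝ] ℝ} {Q : ℝ}

theorem fderiv_eq_of_eventually_le_quadratic (hu : DifferentiableAt ℝ u x)
    (h : ∀ᶠ y in 𝓝 x, u y ≤ u x + l (y - x) + Q * ‖y - x‖ ^ 2) : fderiv ℝ u x = l := by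
  have hmax : IsLocalMax (fun y => u y - l (y - x) - Q * ‖y - x‖ ^ 2) x := by
    filter_upwards [h] with y hy
    simp only [sub_self, map_zero, norm_zero]
    linarith
  have hid : HasFDerivAt (fun y : E => y - x) (ContinuousLinearMap.id ℝ E) x :=
    (hasFDerivAt_id x).sub_const x
  have hd := (hu.hasFDerivAt.sub (l.hasFDerivAt.comp x hid)).sub (hid.norm_sq.const_mul Q)
  have h0 := hmax.hasFDerivAt_eq_zero hd
  ext v
  have := DFunLike.congr_fun h0 v
  simp at this
  linarith

theorem iteratedFDeriv_two_le_of_eventually_le_quadratic (hu : ContDiffAt ℝ 2 u x)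
    (h : ∀ᶠ y in 𝓝 x, u y ≤ u x + l (y - x) + Q * ‖y - x‖ ^ 2) {e : E} (he : ‖e‖ = 1) :
    iteratedFDeriv ℝ 2 u x ![e, e] ≤ 2 * Q := by
  have hline : ∀ t : ℝ, HasDerivAt (fun t : ℝ => x + t • e) e t := fun t => by
    simpa using ((hasDerivAt_id t).smul_const e).const_add x
  have hcont : Tendsto (fun t : ℝ => x + t • e) (𝓝 0) (𝓝 x) := by
    simpa using (hline 0).continuousAt.tendsto
  have hdiff : ∀ᶠ t : ℝ in 𝓝 0, DifferentiableAt ℝ u (x + t • e) :=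
    hcont.eventually ((hu.eventually (by simp)).mono fun y hy => hy.differentiableAt (by norm_num))
  set ψ : ℝ → ℝ := fun t => u (x + t • e) - t * l e - Q * t ^ 2 with hψ
  have hmax : IsLocalMax ψ 0 := by
    filter_upwards [hcont.eventually h] with t ht
    simp only [hψ]
    simp only [add_sub_cancel_left, map_smul, smul_eq_mul, norm_smul, he, mul_one,
      Real.norm_eq_abs, sq_abs] at ht
    simp
    linarith
  have hd : ∀ᶠ t : ℝ in 𝓝 0, HasDerivAt ψ (fderiv ℝ u (x + t • e) e - l e - Q * (2 * t)) t := by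
    filter_upwards [hdiff] with t ht
    have h1 := ht.hasFDerivAt.comp_hasDerivAt t (hline t)
    have h2 := (hasDerivAt_id t).mul_const (l e)
    have h3 := ((hasDerivAt_id t).pow 2).const_mul Q
    convert! (h1.sub h2).sub h3 using 1
    simp
  have hd' : deriv ψ =ᶠ[𝓝 0] fun t => fderiv ℝ u (x + t • e) e - l e - Q * (2 * t) :=
    hd.mono fun t ht => ht.deriv
  have hfd : HasFDerivAt (fderiv ℝ u) (fderiv ℝ (fderiv ℝ u) x) (x + (0 : ℝ) • e) := by
    simpa using ((hu.fderiv_right (m := 1) (by norm_num)).differentiableAt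
      (by norm_num)).hasFDerivAt
  have hdd : HasDerivAt (fun t : ℝ => fderiv ℝ u (x + t • e) e - l e - Q * (2 * t))
      (fderiv ℝ (fderiv ℝ u) x e e - 2 * Q) 0 := by
    have h0 : HasDerivAt (fun t : ℝ => fderiv ℝ u (x + t • e)) (fderiv ℝ (fderiv ℝ u) x e) 0 :=
      hfd.comp_hasDerivAt (0 : ℝ) (hline 0)
    have h1 : HasDerivAt (fun t : ℝ => fderiv ℝ u (x + t • e) e)
        (fderiv ℝ (fderiv ℝ u) x e e) 0 :=
      (ContinuousLinearMap.apply ℝ ℝ e).hasFDerivAt.comp_hasDerivAt (0 : ℝ) h0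
    have h3 : HasDerivAt (fun t : ℝ => Q * (2 * t)) (2 * Q) 0 := by
      simpa [mul_comm] using ((hasDerivAt_id (0 : ℝ)).const_mul 2).const_mul Q
    exact (h1.sub_const (l e)).sub h3
  have := deriv_deriv_nonpos_of_isLocalMax hd.self_of_nhds.continuousAt hmax
  rw [hd'.deriv_eq, hdd.deriv] at this
  rw [iteratedFDeriv_two_apply]
  simpa using this

theorem laplacian_le_of_eventually_le_quadratic [FiniteDimensional ℝ E] (hu : ContDiffAt ℝ 2 u x)
    (h : ∀ᶠ y in 𝓝 x, u y ≤ u x + l (y - x) + Q * ‖y - x‖ ^ 2) :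
    Laplacian.laplacian u x ≤ Module.finrank ℝ E * (2 * Q) := by
  rw [InnerProductSpace.laplacian_eq_iteratedFDeriv_orthonormalBasis u (stdOrthonormalBasis ℝ E)]
  calc _ ≤ ∑ i : Fin (Module.finrank ℝ E), 2 * Q := Finset.sum_le_sum fun i _ =>
        iteratedFDeriv_two_le_of_eventually_le_quadratic hu h
          ((stdOrthonormalBasis ℝ E).orthonormal.1 i)
    _ = _ := by simp

end touching

/-! ### Integrability of power kernels, in polar coordinates. -/

section kernels

variable {E : Type*} [NormedAddCommGroup E] [NormedSpace ℝ E] [FiniteDimensional ℝ E]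
  [Nontrivial E] [MeasurableSpace E] [BorelSpace E] (μ : Measure E) [μ.IsAddHaarMeasure]

theorem integrableOn_ball_norm_rpow {a : ℝ} (ha : -(Module.finrank ℝ E : ℝ) < a) :
    IntegrableOn (fun z : E => ‖z‖ ^ a) (Metric.ball 0 1) μ := by
  have hn : 1 ≤ Module.finrank ℝ E := Module.finrank_pos
  rw [← integrable_indicator_iff Metric.isOpen_ball.measurableSet]
  have : (Metric.ball (0 : E) 1).indicator (fun z : E => ‖z‖ ^ a) =
      fun z : E => (Set.Iio (1 : ℝ)).indicator (fun t => t ^ a) ‖z‖ := by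
    ext z; simp [Set.indicator]
  rw [this, integrable_fun_norm_addHaar]
  have h1 : IntegrableOn (fun t : ℝ => t ^ ((Module.finrank ℝ E : ℝ) - 1 + a)) (Set.Ioo 0 1) :=
    (intervalIntegral.integrableOn_Ioo_rpow_iff one_pos).2 (by linarith)
  rw [← integrable_indicator_iff measurableSet_Ioo] at h1
  rw [← integrable_indicator_iff measurableSet_Ioi]
  refine h1.congr (ae_of_all _ fun t => ?_)
  by_cases h0 : 0 < t <;> by_cases h2 : t < 1 <;> simp [Set.indicator, h0, h2]
  rw [Real.rpow_add h0, ← Real.rpow_natCast, Nat.cast_sub hn, Nat.cast_one]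

theorem integrableOn_compl_ball_norm_rpow {a ε : ℝ} (hε : 0 < ε)
    (ha : a < -(Module.finrank ℝ E : ℝ)) :
    IntegrableOn (fun z : E => ‖z‖ ^ a) (Metric.ball 0 ε)ᶜ μ := by
  have hn : 1 ≤ Module.finrank ℝ E := Module.finrank_pos
  rw [← integrable_indicator_iff Metric.isOpen_ball.measurableSet.compl]
  have : (Metric.ball (0 : E) ε)ᶜ.indicator (fun z : E => ‖z‖ ^ a) =
      fun z : E => (Set.Ici ε).indicator (fun t => t ^ a) ‖z‖ := by
    ext z; simp [Set.indicator]
  rw [this, integrable_fun_norm_addHaar]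
  have h1 : IntegrableOn (fun t : ℝ => t ^ ((Module.finrank ℝ E : ℝ) - 1 + a)) (Set.Ici ε) :=
    integrableOn_Ici_iff_integrableOn_Ioi (by finiteness) |>.2 (integrableOn_Ioi_rpow_of_lt (by linarith) hε)
  rw [← integrable_indicator_iff measurableSet_Ici] at h1
  rw [← integrable_indicator_iff measurableSet_Ioi]
  refine h1.congr (ae_of_all _ fun t => ?_)
  by_cases h2 : ε ≤ t
  · have h0 : 0 < t := hε.trans_le h2
    simp [Set.indicator, h0, h2]
    rw [Real.rpow_add h0, ← Real.rpow_natCast, Nat.cast_sub hn, Nat.cast_one]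
  · simp [Set.indicator, h2]

end kernels

theorem MeasureTheory.MemLp.exists_ae_abs_le {α : Type*} [MeasurableSpace α] {μ : Measure α}
    {f : α → ℝ} (hf : MemLp f ⊤ μ) : ∃ B ≥ 0, ∀ᵐ x ∂μ, |f x| ≤ B := by
  have hfin : eLpNormEssSup f μ ≠ ⊤ := by
    have := hf.2.ne
    rwa [eLpNorm_exponent_top] at this
  refine ⟨(eLpNormEssSup f μ).toReal, ENNReal.toReal_nonneg, ?_⟩
  filter_upwards [ae_le_eLpNormEssSup (f := f) (μ := μ)] with x hx
  have := (ENNReal.toReal_le_toReal (by simp) hfin).2 hx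
  simpa using this

/-! ### Behaviour of Haar measure under affine dilations. -/

section dilation

variable {E : Type*} [NormedAddCommGroup E] [NormedSpace ℝ E] [FiniteDimensional ℝ E]
  [MeasurableSpace E] [BorelSpace E] (μ : Measure E) [μ.IsAddHaarMeasure]

theorem quasiMeasurePreserving_add_smul (x : E) {r : ℝ} (hr : r ≠ 0) :
    Measure.QuasiMeasurePreserving (fun z : E => x + r • z) μ μ := by
  have h1 : Measure.QuasiMeasurePreserving (fun z : E => r • z) μ μ := by
    refine ⟨measurable_const_smul r, ?_⟩
    rw [Measure.map_addHaar_smul μ hr]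
    exact Measure.smul_absolutelyContinuous
  exact (measurePreserving_add_left μ x).quasiMeasurePreserving.comp h1

theorem integral_add_smul (f : E → ℝ) (x : E) {r : ℝ} (hr : 0 < r) :
    ∫ y, f y ∂μ = r ^ (Module.finrank ℝ E) * ∫ z, f (x + r • z) ∂μ := by
  rw [Measure.integral_comp_smul μ (fun y => f (x + y)) r, integral_add_left_eq_self, abs_inv,
    abs_of_pos (by positivity), smul_eq_mul, mul_inv_cancel_left₀ (by positivity)]

end dilation

/-! ### Existence and scaling of the principal value. -/

section principalValue

variable {N : ℕ} {σ : ℝ} {v : EuclideanSpace ℝ (Fin N) → ℝ}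
  {L : EuclideanSpace ℝ (Fin N) →L[ℝ] ℝ}

/-- The integrand of `(-Δ)^σ v(0)` after subtraction of the odd linear part on the unit ball. -/
noncomputable def compensatedIntegrand (σ : ℝ) (v : EuclideanSpace ℝ (Fin N) → ℝ)
    (L : EuclideanSpace ℝ (Fin N) →L[ℝ] ℝ) (z : EuclideanSpace ℝ (Fin N)) : ℝ :=
  (v 0 - v z + (Metric.ball 0 1).indicator L z) / ‖z‖ ^ ((N : ℝ) + 2 * σ)

theorem integrable_compensatedIntegrand [NeZero N] (hσ : σ ∈ Set.Ioo (0 : ℝ) 1)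
    (hv : MemLp v ⊤ volume) {C : ℝ} (hT : ∀ᶠ z in 𝓝 0, |v z - v 0 - L z| ≤ C * ‖z‖ ^ 2) :
    Integrable (compensatedIntegrand σ v L) := by
  obtain ⟨B, hB0, hB⟩ := hv.exists_ae_abs_le
  obtain ⟨ρ, hρ, hTρ⟩ := Metric.eventually_nhds_iff_ball.1 hT
  -- The quadratic bound is known only for `‖z‖ < ρ`. The second term extends it to the unit ball,
  -- by dividing the crude bound by `ρ ^ 2`.
  set C' := |C| + (|v 0| + B + ‖L‖) / ρ ^ 2 with hC'
  have hI1 := integrableOn_ball_norm_rpow (E := EuclideanSpace ℝ (Fin N)) volume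
    (a := 2 - ((N : ℝ) + 2 * σ)) (by simp; linarith [hσ.2])
  have hI2 := integrableOn_compl_ball_norm_rpow (E := EuclideanSpace ℝ (Fin N)) volume
    (a := - ((N : ℝ) + 2 * σ)) one_pos (by simp; linarith [hσ.1])
  rw [← integrable_indicator_iff Metric.isOpen_ball.measurableSet] at hI1
  rw [← integrable_indicator_iff Metric.isOpen_ball.measurableSet.compl] at hI2
  refine ((hI1.const_mul C').add (hI2.const_mul (|v 0| + B))).mono' ?_ ?_
  · have h1 : AEMeasurable v := hv.1.aemeasurable
    have h2 : Measurable ((Metric.ball 0 1).indicator L) :=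
      L.measurable.indicator Metric.isOpen_ball.measurableSet
    have h3 : Measurable fun z : EuclideanSpace ℝ (Fin N) => ‖z‖ ^ ((N : ℝ) + 2 * σ) := by
      fun_prop
    exact (((h1.const_sub (v 0)).add h2.aemeasurable).div h3.aemeasurable).aestronglyMeasurable
  · filter_upwards [hB, compl_mem_ae_iff.2 (measure_singleton (0 : EuclideanSpace ℝ (Fin N)))]
      with z hz hz0
    have hzpos : 0 < ‖z‖ := norm_pos_iff.2 hz0
    have hbd : |v 0 - v z| ≤ |v 0| + B := (abs_sub _ _).trans (by linarith)
    rw [compensatedIntegrand, Real.norm_eq_abs, abs_div,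
      abs_of_pos (Real.rpow_pos_of_pos hzpos _), div_eq_mul_inv, ← Real.rpow_neg hzpos.le]
    by_cases hz1 : z ∈ Metric.ball (0 : EuclideanSpace ℝ (Fin N)) 1
    · simp only [Pi.add_apply, Set.indicator_of_mem hz1,
        Set.indicator_of_notMem (Set.notMem_compl_iff.2 hz1), mul_zero, add_zero]
      have hnum : |v 0 - v z + L z| ≤ C' * ‖z‖ ^ 2 := by
        by_cases hzρ : z ∈ Metric.ball (0 : EuclideanSpace ℝ (Fin N)) ρ
        · have h1 := hTρ z hzρ
          rw [show v 0 - v z + L z = -(v z - v 0 - L z) by ring, abs_neg]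
          refine h1.trans ?_
          gcongr
          have : 0 ≤ (|v 0| + B + ‖L‖) / ρ ^ 2 := by positivity
          linarith [le_abs_self C]
        · have hzn : ‖z‖ < 1 := by simpa using hz1
          have hzr : ρ ≤ ‖z‖ := by simpa using hzρ
          have hL : |L z| ≤ ‖L‖ := by
            refine (L.le_opNorm z).trans ?_
            exact mul_le_of_le_one_right (norm_nonneg _) hzn.le
          calc |v 0 - v z + L z| ≤ |v 0 - v z| + |L z| := abs_add_le _ _
            _ ≤ |v 0| + B + ‖L‖ := by linarith
            _ = (|v 0| + B + ‖L‖) / ρ ^ 2 * ρ ^ 2 := by field_simp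
            _ ≤ (|v 0| + B + ‖L‖) / ρ ^ 2 * ‖z‖ ^ 2 := by gcongr
            _ ≤ C' * ‖z‖ ^ 2 := by
              gcongr
              rw [hC']
              linarith [abs_nonneg C]
      calc _ ≤ C' * ‖z‖ ^ 2 * ‖z‖ ^ (-((N : ℝ) + 2 * σ)) := by gcongr
        _ = C' * ‖z‖ ^ (2 - ((N : ℝ) + 2 * σ)) := by
          rw [mul_assoc, ← Real.rpow_natCast, ← Real.rpow_add hzpos]
          norm_num [sub_eq_add_neg]
    · simp only [Pi.add_apply, Set.indicator_of_notMem hz1,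
        Set.indicator_of_mem (Set.mem_compl hz1), mul_zero, add_zero, zero_add]
      gcongr

/-- The integrand is odd and the domain symmetric, so the integral equals its own negative;
integrability is not needed. -/
theorem setIntegral_linear_compl_ball_eq_zero (L : EuclideanSpace ℝ (Fin N) →L[ℝ] ℝ) (s ε : ℝ) :
    ∫ z in (Metric.ball (0 : EuclideanSpace ℝ (Fin N)) ε)ᶜ,
      (Metric.ball 0 1).indicator L z / ‖z‖ ^ s = 0 := by
  rw [← integral_indicator Metric.isOpen_ball.measurableSet.compl]
  refine self_eq_neg.1 ?_
  rw [← integral_neg]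
  rw [← integral_neg_eq_self]
  refine integral_congr_ae (ae_of_all _ fun z => ?_)
  by_cases h1 : ε ≤ ‖z‖ <;> by_cases h2 : ‖z‖ < 1 <;> simp [Set.indicator, h1, h2, neg_div]

/-- Adding the odd linear part leaves every truncated integral unchanged but makes the full integral
absolutely convergent, so dominated convergence applies. -/
theorem tendsto_fracLaplacianTrunc_zero [NeZero N] (hσ : σ ∈ Set.Ioo (0 : ℝ) 1)
    (hv : MemLp v ⊤ volume) {C : ℝ} (hT : ∀ᶠ z in 𝓝 0, |v z - v 0 - L z| ≤ C * ‖z‖ ^ 2) :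
    Tendsto (fracLaplacianTrunc σ v 0) (𝓝[>] 0)
      (𝓝 (fracLaplacianConst N σ * ∫ z, compensatedIntegrand σ v L z)) := by
  have hG := integrable_compensatedIntegrand hσ hv hT
  have key : Tendsto (fun ε : ℝ => ∫ z in (Metric.ball 0 ε)ᶜ, compensatedIntegrand σ v L z)
      (𝓝[>] 0) (𝓝 (∫ z, compensatedIntegrand σ v L z)) := by
    simp_rw [← integral_indicator Metric.isOpen_ball.measurableSet.compl]
    refine tendsto_integral_filter_of_dominated_convergence
      (fun z => ‖compensatedIntegrand σ v L z‖) ?_ ?_ hG.norm ?_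
    · exact Eventually.of_forall fun ε =>
        hG.1.indicator Metric.isOpen_ball.measurableSet.compl
    · exact Eventually.of_forall fun ε => ae_of_all _ fun z => norm_indicator_le_norm_self _ _
    · refine ae_of_all _ fun z => ?_
      rcases eq_or_ne z 0 with rfl | hz
      · have h0 : compensatedIntegrand σ v L 0 = 0 := by simp [compensatedIntegrand]
        have h1 : ∀ ε : ℝ, (Metric.ball (0 : EuclideanSpace ℝ (Fin N)) ε)ᶜ.indicator
            (compensatedIntegrand σ v L) 0 = 0 := fun ε => by
          simp [Set.indicator, h0]
        simp [h0, h1]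
      · refine tendsto_const_nhds.congr' ?_
        have : ∀ᶠ ε : ℝ in 𝓝[>] 0, ε < ‖z‖ :=
          nhdsWithin_le_nhds (Iio_mem_nhds (norm_pos_iff.2 hz))
        filter_upwards [this] with ε hε
        rw [Set.indicator_of_mem]
        simpa using hε.le
  refine (key.const_mul (fracLaplacianConst N σ)).congr' ?_
  filter_upwards [self_mem_nhdsWithin] with ε hε
  rw [fracLaplacianTrunc]
  congr 1
  have hdecomp : ∀ z, compensatedIntegrand σ v L z = (v 0 - v z) / ‖0 - z‖ ^ ((N : ℝ) + 2 * σ)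
      + (Metric.ball 0 1).indicator L z / ‖z‖ ^ ((N : ℝ) + 2 * σ) := fun z => by
    rw [compensatedIntegrand, add_div, zero_sub, norm_neg]
  have hI : IntegrableOn (fun z => (v 0 - v z) / ‖0 - z‖ ^ ((N : ℝ) + 2 * σ))
      (Metric.ball 0 ε)ᶜ := by
    have hI2 := integrableOn_compl_ball_norm_rpow (E := EuclideanSpace ℝ (Fin N)) volume
      (a := - ((N : ℝ) + 2 * σ)) (Set.mem_Ioi.1 hε) (by simp; linarith [hσ.1])
    obtain ⟨B, hB0, hB⟩ := hv.exists_ae_abs_le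
    have h2 : Integrable (fun z : EuclideanSpace ℝ (Fin N) =>
        (v 0 - v z) * ‖z‖ ^ (-((N : ℝ) + 2 * σ))) (volume.restrict (Metric.ball 0 ε)ᶜ) := by
      refine hI2.bdd_mul (c := |v 0| + B) ?_ ?_
      · exact (aestronglyMeasurable_const.sub hv.1).restrict
      · refine ae_restrict_of_ae ?_
        filter_upwards [hB] with z hz
        exact (abs_sub _ _).trans (by linarith)
    refine h2.congr (ae_of_all _ fun z => ?_)
    simp only [zero_sub, norm_neg]
    rw [Real.rpow_neg (norm_nonneg _), div_eq_mul_inv]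
  have hJ : IntegrableOn (fun z => (Metric.ball 0 1).indicator L z / ‖z‖ ^ ((N : ℝ) + 2 * σ))
      (Metric.ball 0 ε)ᶜ := by
    refine (hG.integrableOn.sub hI).congr (ae_of_all _ fun z => ?_)
    simp [hdecomp]
  simp_rw [hdecomp]
  rw [integral_add hI hJ, setIntegral_linear_compl_ball_eq_zero, add_zero]

theorem fracLaplacianTrunc_eq_dilation (σ : ℝ) (u : EuclideanSpace ℝ (Fin N) → ℝ)
    (x : EuclideanSpace ℝ (Fin N)) {r : ℝ} (hr : 0 < r) (ε : ℝ) :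
    fracLaplacianTrunc σ u x ε =
      r ^ (-(2 * σ)) * fracLaplacianTrunc σ (fun z => u (x + r • z)) 0 (ε / r) := by
  rw [fracLaplacianTrunc, fracLaplacianTrunc, mul_left_comm]
  congr 1
  rw [← integral_indicator Metric.isOpen_ball.measurableSet.compl,
    ← integral_indicator Metric.isOpen_ball.measurableSet.compl,
    integral_add_smul volume _ x hr, ← integral_const_mul, ← integral_const_mul]
  refine integral_congr_ae (ae_of_all _ fun z => ?_)
  have h1 : (x + r • z ∈ (Metric.ball x ε)ᶜ) ↔ z ∈ (Metric.ball 0 (ε / r))ᶜ := by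
    simp [norm_smul, abs_of_pos hr, div_le_iff₀' hr]
  by_cases hz : z ∈ (Metric.ball (0 : EuclideanSpace ℝ (Fin N)) (ε / r))ᶜ
  · simp only [Set.indicator_of_mem hz, Set.indicator_of_mem (h1.2 hz)]
    simp only [sub_add_cancel_left, norm_neg, norm_smul, Real.norm_eq_abs, abs_of_pos hr,
      smul_zero, add_zero, zero_sub]
    rw [Real.mul_rpow hr.le (norm_nonneg _), Real.rpow_neg hr.le, Real.rpow_add hr,
      Real.rpow_natCast, finrank_euclideanSpace_fin]
    field_simp
  · simp only [Set.indicator_of_notMem hz, Set.indicator_of_notMem (mt h1.1 hz), mul_zero]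

end principalValue

/-! ### Lower bound for the fractional Laplacian at a touching point. -/

section lowerBound

variable {N : ℕ} {σ : ℝ}

theorem fracLaplacianConst_pos (N : ℕ) [NeZero N] (hσ : σ ∈ Set.Ioo (0 : ℝ) 1) :
    0 < fracLaplacianConst N σ := by
  have h0 := hσ.1
  have h1 : 0 < 1 - σ := by linarith [hσ.2]
  have := Real.Gamma_pos_of_pos h1
  have h2 : 0 < Real.Gamma ((N : ℝ) / 2 + σ) := Real.Gamma_pos_of_pos (by positivity)
  have := Real.pi_pos
  unfold fracLaplacianConst
  positivity

/-- A pointwise comparison: touching controls the unit ball, near-maximality costs `δ` outside it,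
and the drop `m` gains on `Metric.ball e 1`, which `2 ≤ ‖e‖` makes disjoint from the unit ball. -/
theorem integral_compensatedIntegrand_ge [NeZero N] (hσ : σ ∈ Set.Ioo (0 : ℝ) 1)
    {v : EuclideanSpace ℝ (Fin N) → ℝ} {L : EuclideanSpace ℝ (Fin N) →L[ℝ] ℝ}
    {e : EuclideanSpace ℝ (Fin N)} {q δ m : ℝ} (he : 2 ≤ ‖e‖) (hδ : 0 ≤ δ) (hm : 0 ≤ m)
    (hG : Integrable (compensatedIntegrand σ v L))
    (htouch : ∀ z ∈ Metric.ball (0 : EuclideanSpace ℝ (Fin N)) 1, v z ≤ v 0 + L z + q * ‖z‖ ^ 2)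
    (hle : ∀ᵐ z, v z ≤ v 0 + δ)
    (hext : ∀ᵐ z, z ∈ Metric.ball e 1 → v z ≤ v 0 - m) :
    m * ((‖e‖ + 1) ^ (-((N : ℝ) + 2 * σ)) * volume.real (Metric.ball e 1))
      - q * (∫ z in Metric.ball (0 : EuclideanSpace ℝ (Fin N)) 1, ‖z‖ ^ (2 - ((N : ℝ) + 2 * σ)))
      - δ * (∫ z in (Metric.ball (0 : EuclideanSpace ℝ (Fin N)) 1)ᶜ, ‖z‖ ^ (-((N : ℝ) + 2 * σ)))
      ≤ ∫ z, compensatedIntegrand σ v L z := by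
  have hI1 := integrableOn_ball_norm_rpow (E := EuclideanSpace ℝ (Fin N)) volume
    (a := 2 - ((N : ℝ) + 2 * σ)) (by simp; linarith [hσ.2])
  have hI2 := integrableOn_compl_ball_norm_rpow (E := EuclideanSpace ℝ (Fin N)) volume
    (a := - ((N : ℝ) + 2 * σ)) one_pos (by simp; linarith [hσ.1])
  have hI3 : IntegrableOn (fun _ => (‖e‖ + 1) ^ (-((N : ℝ) + 2 * σ))) (Metric.ball e 1) :=
    integrableOn_const (by finiteness)
  have hs3 : ∫ _ in Metric.ball e 1, (‖e‖ + 1) ^ (-((N : ℝ) + 2 * σ)) =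
      (‖e‖ + 1) ^ (-((N : ℝ) + 2 * σ)) * volume.real (Metric.ball e 1) := by
    rw [setIntegral_const, smul_eq_mul, mul_comm]
  rw [← hs3, ← integral_indicator Metric.isOpen_ball.measurableSet,
    ← integral_indicator Metric.isOpen_ball.measurableSet,
    ← integral_indicator Metric.isOpen_ball.measurableSet.compl,
    ← integral_const_mul, ← integral_const_mul, ← integral_const_mul]
  rw [← integrable_indicator_iff Metric.isOpen_ball.measurableSet] at hI1 hI3
  rw [← integrable_indicator_iff Metric.isOpen_ball.measurableSet.compl] at hI2
  rw [← integral_sub (hI3.const_mul m) (hI1.const_mul q)]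
  have hI13 : Integrable fun z =>
      m * (Metric.ball e 1).indicator (fun _ => (‖e‖ + 1) ^ (-((N : ℝ) + 2 * σ))) z -
        q * (Metric.ball (0 : EuclideanSpace ℝ (Fin N)) 1).indicator
          (fun z => ‖z‖ ^ (2 - ((N : ℝ) + 2 * σ))) z :=
    (hI3.const_mul m).sub (hI1.const_mul q)
  rw [← integral_sub hI13 (hI2.const_mul δ)]
  refine integral_mono_ae (hI13.sub (hI2.const_mul δ)) hG ?_
  filter_upwards [hle, hext, compl_mem_ae_iff.2 (measure_singleton (0 : EuclideanSpace ℝ (Fin N)))]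
    with z hz hze hz0
  have hzpos : 0 < ‖z‖ := norm_pos_iff.2 hz0
  have hk : 0 < ‖z‖ ^ (-((N : ℝ) + 2 * σ)) := Real.rpow_pos_of_pos hzpos _
  rw [compensatedIntegrand, div_eq_mul_inv, ← Real.rpow_neg hzpos.le]
  by_cases hz1 : z ∈ Metric.ball (0 : EuclideanSpace ℝ (Fin N)) 1
  · have hze' : z ∉ Metric.ball e 1 := fun h => by
      have h1 : ‖z‖ < 1 := by simpa using hz1
      have h2 : ‖z - e‖ < 1 := by simpa [dist_eq_norm] using h
      have h3 := norm_sub_norm_le e z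
      rw [norm_sub_rev] at h3
      linarith
    simp only [Set.indicator_of_mem hz1, Set.indicator_of_notMem hze',
      Set.indicator_of_notMem (Set.notMem_compl_iff.2 hz1), mul_zero, zero_sub, sub_zero]
    have := htouch z hz1
    calc -(q * ‖z‖ ^ (2 - ((N : ℝ) + 2 * σ)))
        = -(q * ‖z‖ ^ 2) * ‖z‖ ^ (-((N : ℝ) + 2 * σ)) := by
          rw [sub_eq_add_neg, Real.rpow_add hzpos]
          norm_num
          ring
      _ ≤ _ := mul_le_mul_of_nonneg_right (by linarith) hk.le
  · simp only [Set.indicator_of_notMem hz1,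
      Set.indicator_of_mem (Set.mem_compl hz1), mul_zero, sub_zero, add_zero]
    by_cases hze' : z ∈ Metric.ball e 1
    · simp only [Set.indicator_of_mem hze']
      have h1 := hze hze'
      have h2 : ‖z‖ ≤ ‖e‖ + 1 := by
        have h2 : ‖z - e‖ < 1 := by simpa [dist_eq_norm] using hze'
        linarith [norm_sub_norm_le z e]
      have h3 : (‖e‖ + 1) ^ (-((N : ℝ) + 2 * σ)) ≤ ‖z‖ ^ (-((N : ℝ) + 2 * σ)) :=
        Real.rpow_le_rpow_of_nonpos hzpos h2 (by linarith [hσ.1, Nat.cast_nonneg (α := ℝ) N])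
      calc _ ≤ m * ‖z‖ ^ (-((N : ℝ) + 2 * σ)) := by
            have : 0 ≤ δ * ‖z‖ ^ (-((N : ℝ) + 2 * σ)) := by positivity
            have := mul_le_mul_of_nonneg_left h3 hm
            linarith
        _ ≤ _ := mul_le_mul_of_nonneg_right (by linarith) hk.le
    · simp only [Set.indicator_of_notMem hze', mul_zero, zero_sub]
      rw [← neg_mul]
      exact mul_le_mul_of_nonneg_right (by linarith) hk.le

/-- Rescaling by `r` reduces to the unit-scale bound: the kernel yields `r ^ (-(2 * σ))` and the
opening `Q` becomes `Q * r ^ 2`. -/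
theorem fracLaplacian_ge_of_le_quadratic [NeZero N] (hσ : σ ∈ Set.Ioo (0 : ℝ) 1)
    {u : EuclideanSpace ℝ (Fin N) → ℝ} {x e : EuclideanSpace ℝ (Fin N)}
    {l : EuclideanSpace ℝ (Fin N) →L[ℝ] ℝ} {r Q δ m : ℝ} (hr : 0 < r)
    (he : 2 ≤ ‖e‖) (hδ : 0 ≤ δ) (hm : 0 ≤ m)
    (hu : MemLp u ⊤ volume) (hux : ContDiffAt ℝ 2 u x)
    (htouch : ∀ y ∈ Metric.ball x r, u y ≤ u x + l (y - x) + Q * ‖y - x‖ ^ 2)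
    (hle : ∀ᵐ y, u y ≤ u x + δ)
    (hext : ∀ᵐ y, y ∈ Metric.ball (x + r • e) r → u y ≤ u x - m) :
    fracLaplacianConst N σ * r ^ (-(2 * σ)) *
      (m * ((‖e‖ + 1) ^ (-((N : ℝ) + 2 * σ)) * volume.real (Metric.ball e 1))
      - Q * r ^ 2 *
        (∫ z in Metric.ball (0 : EuclideanSpace ℝ (Fin N)) 1, ‖z‖ ^ (2 - ((N : ℝ) + 2 * σ)))
      - δ * (∫ z in (Metric.ball (0 : EuclideanSpace ℝ (Fin N)) 1)ᶜ, ‖z‖ ^ (-((N : ℝ) + 2 * σ))))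
      ≤ fracLaplacian σ u x := by
  have hq := quasiMeasurePreserving_add_smul (volume : Measure (EuclideanSpace ℝ (Fin N))) x hr.ne'
  set v : EuclideanSpace ℝ (Fin N) → ℝ := fun z => u (x + r • z) with hv
  have hvL : MemLp v ⊤ volume := by
    obtain ⟨B, hB0, hB⟩ := hu.exists_ae_abs_le
    exact memLp_top_of_bound (hu.1.comp_quasiMeasurePreserving hq) B (hq.ae hB)
  have hl : fderiv ℝ u x = l :=
    fderiv_eq_of_eventually_le_quadratic (hux.differentiableAt (by norm_num))
      (Metric.eventually_nhds_iff_ball.2 ⟨r, hr, htouch⟩)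
  obtain ⟨ρ, hρ, C, hC, hTaylor⟩ := hux.exists_abs_sub_sub_fderiv_le
  have hT : ∀ᶠ z : EuclideanSpace ℝ (Fin N) in 𝓝 0, |v z - v 0 - (r • l) z| ≤ C * r ^ 2 * ‖z‖ ^ 2 := by
    have hc : Tendsto (fun z : EuclideanSpace ℝ (Fin N) => x + r • z) (𝓝 0) (𝓝 x) := by
      have : Continuous fun z : EuclideanSpace ℝ (Fin N) => x + r • z := by fun_prop
      simpa using this.tendsto 0
    filter_upwards [hc.eventually (Metric.ball_mem_nhds x hρ)] with z hz
    have := hTaylor x (Metric.mem_ball_self hρ) _ hz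
    rw [hl, add_sub_cancel_left, norm_smul, mul_pow, Real.norm_eq_abs, sq_abs, ← mul_assoc] at this
    simpa [hv] using this
  have hlim := tendsto_fracLaplacianTrunc_zero hσ hvL hT
  have hscale : Tendsto (fun ε : ℝ => ε / r) (𝓝[>] 0) (𝓝[>] 0) := by
    refine tendsto_nhdsWithin_iff.2 ⟨?_, ?_⟩
    · refine Tendsto.mono_left ?_ nhdsWithin_le_nhds
      have : Continuous fun ε : ℝ => ε / r := by fun_prop
      simpa using this.tendsto 0
    · filter_upwards [self_mem_nhdsWithin] with ε hε using div_pos hε hr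
  have hlim' : Tendsto (fracLaplacianTrunc σ u x) (𝓝[>] 0) (𝓝 (r ^ (-(2 * σ)) *
      (fracLaplacianConst N σ * ∫ z, compensatedIntegrand σ v (r • l) z))) := by
    refine ((hlim.comp hscale).const_mul (r ^ (-(2 * σ)))).congr fun ε => ?_
    rw [fracLaplacianTrunc_eq_dilation σ u x hr ε]
    rfl
  rw [fracLaplacian, hlim'.limUnder_eq]
  have hc : 0 ≤ fracLaplacianConst N σ * r ^ (-(2 * σ)) :=
    mul_nonneg (fracLaplacianConst_pos N hσ).le (Real.rpow_nonneg hr.le _)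
  refine (mul_le_mul_of_nonneg_left (integral_compensatedIntegrand_ge hσ he hδ hm
    (integrable_compensatedIntegrand hσ hvL hT) ?_ ?_ ?_) hc).trans_eq (by ring)
  · intro z hz
    have hz' : x + r • z ∈ Metric.ball x r := by
      have : ‖z‖ < 1 := by simpa using hz
      simpa [norm_smul, abs_of_pos hr] using mul_lt_of_lt_one_right hr this
    have := htouch _ hz'
    rw [add_sub_cancel_left, norm_smul, mul_pow, Real.norm_eq_abs, sq_abs, ← mul_assoc] at this
    simpa [hv] using this
  · filter_upwards [hq.ae hle] with z hz
    simpa [hv] using hz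
  · filter_upwards [hq.ae hext] with z hz hze
    have hz' : x + r • z ∈ Metric.ball (x + r • e) r := by
      have h1 : ‖z - e‖ < 1 := by simpa [dist_eq_norm] using hze
      have : ‖r • (z - e)‖ < r := by
        rw [norm_smul, Real.norm_eq_abs, abs_of_pos hr]
        exact mul_lt_of_lt_one_right hr h1
      simpa [dist_eq_norm, smul_sub] using this
    simpa [hv] using hz hz'

end lowerBound

/-! ### The scaling contradiction. -/

/-- The threshold `η` does not depend on `u`, `x`, `r` or `Q`, so `η` can be fixed before the
touching point is produced. -/
theorem exists_threshold_equation_ne_zero {N : ℕ} [NeZero N] {σ p : ℝ}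
    (hσ : σ ∈ Set.Ioo (0 : ℝ) 1) (hp : 1 ≤ p) (hσp : 1 ≤ σ * p)
    {e : EuclideanSpace ℝ (Fin N)} (he : 2 ≤ ‖e‖) {m : ℝ} (hm : 0 < m) :
    ∃ η > 0, ∀ (u : EuclideanSpace ℝ (Fin N) → ℝ) (x : EuclideanSpace ℝ (Fin N))
      (l : EuclideanSpace ℝ (Fin N) →L[ℝ] ℝ) (r Q : ℝ), 0 < r → r ≤ 1 → Q * r ^ 2 ≤ η →
      MemLp u ⊤ volume → ContDiffAt ℝ 2 u x →
      (∀ y ∈ Metric.ball x r, u y ≤ u x + l (y - x) + Q * ‖y - x‖ ^ 2) →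
      (∀ᵐ y, u y ≤ u x + η) →
      (∀ᵐ y, y ∈ Metric.ball (x + r • e) r → u y ≤ u x - m) →
      -Laplacian.laplacian u x + |fracLaplacian σ u x| ^ (p - 1) * fracLaplacian σ u x ≠ 0 := by
  have hc := fracLaplacianConst_pos N hσ
  set c := fracLaplacianConst N σ
  set J := (‖e‖ + 1) ^ (-((N : ℝ) + 2 * σ)) * volume.real (Metric.ball e 1) with hJ
  set I₁ := ∫ z in Metric.ball (0 : EuclideanSpace ℝ (Fin N)) 1, ‖z‖ ^ (2 - ((N : ℝ) + 2 * σ))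
    with hI₁
  set I₂ := ∫ z in (Metric.ball (0 : EuclideanSpace ℝ (Fin N)) 1)ᶜ, ‖z‖ ^ (-((N : ℝ) + 2 * σ))
    with hI₂
  have hJpos : 0 < J := by
    have h1 : 0 < volume.real (Metric.ball e 1) :=
      ENNReal.toReal_pos (Metric.measure_ball_pos volume e one_pos).ne' (by finiteness)
    have h2 : 0 < ‖e‖ + 1 := by positivity
    positivity
  have hI₁0 : 0 ≤ I₁ := integral_nonneg fun z => by positivity
  have hI₂0 : 0 ≤ I₂ := integral_nonneg fun z => by positivity
  set m₀ := c * (m * J / 2) with hm₀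
  have hm₀pos : 0 < m₀ := by positivity
  have hmp : 0 < m₀ ^ p := Real.rpow_pos_of_pos hm₀pos p
  -- The first condition keeps half of the gain `m * J`; the second contradicts `m₀ ^ p ≤ 2 * N * (Q
  -- * r ^ 2)`, which the equation would force.
  obtain ⟨η, hη, h1, h2⟩ : ∃ η > 0, η * (I₁ + I₂) < m * J / 2 ∧ 2 * N * η < m₀ ^ p := by
    have t1 : Tendsto (fun η : ℝ => η * (I₁ + I₂)) (𝓝[>] 0) (𝓝 0) := by
      have : Continuous fun η : ℝ => η * (I₁ + I₂) := by fun_prop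
      simpa using (this.tendsto 0).mono_left nhdsWithin_le_nhds
    have t2 : Tendsto (fun η : ℝ => 2 * N * η) (𝓝[>] 0) (𝓝 0) := by
      have : Continuous fun η : ℝ => 2 * N * η := by fun_prop
      simpa using (this.tendsto 0).mono_left nhdsWithin_le_nhds
    have hJ2 : 0 < m * J / 2 := by positivity
    obtain ⟨η, h⟩ := (eventually_mem_nhdsWithin.and
      ((t1.eventually_lt_const hJ2).and (t2.eventually_lt_const hmp))).exists
    exact ⟨η, h⟩
  refine ⟨η, hη, fun u x l r Q hr hr1 hQ hu hux htouch hle hext heq => ?_⟩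
  set A := fracLaplacian σ u x with hA
  have hfrac := fracLaplacian_ge_of_le_quadratic hσ hr he hη.le hm.le hu hux htouch hle hext
  have hAge : m₀ * r ^ (-(2 * σ)) ≤ A := by
    refine le_trans ?_ hfrac
    have h3 : m * J / 2 ≤ m * J - Q * r ^ 2 * I₁ - η * I₂ := by
      have := mul_le_mul_of_nonneg_right hQ hI₁0
      linarith
    calc m₀ * r ^ (-(2 * σ)) = c * r ^ (-(2 * σ)) * (m * J / 2) := by rw [hm₀]; ring
      _ ≤ _ := by gcongr
  have hApos : 0 < A := lt_of_lt_of_le (by positivity) hAge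
  have hApow : |A| ^ (p - 1) * A = A ^ p := by
    rw [abs_of_pos hApos]
    nth_rewrite 2 [← Real.rpow_one A]
    rw [← Real.rpow_add hApos, sub_add_cancel]
  -- The condition `1 ≤ σ * p` enters here, with `r ≤ 1`: the nonlocal term is at least as singular
  -- as the Laplacian bound.
  have hAp : m₀ ^ p * r ^ (-2 : ℝ) ≤ A ^ p := by
    calc m₀ ^ p * r ^ (-2 : ℝ) ≤ m₀ ^ p * r ^ (-(2 * σ) * p) := by
          gcongr ?_ * ?_
          exact Real.rpow_le_rpow_of_exponent_ge hr hr1 (by linarith)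
      _ = (m₀ * r ^ (-(2 * σ))) ^ p := by
          rw [Real.mul_rpow hm₀pos.le (by positivity), ← Real.rpow_mul hr.le]
      _ ≤ A ^ p := by gcongr
  have hlap := laplacian_le_of_eventually_le_quadratic hux
    (Metric.eventually_nhds_iff_ball.2 ⟨r, hr, htouch⟩)
  rw [finrank_euclideanSpace_fin] at hlap
  rw [hApow] at heq
  have h4 : m₀ ^ p * r ^ (-2 : ℝ) ≤ N * (2 * Q) := by linarith
  have h5 : m₀ ^ p ≤ N * (2 * Q) * r ^ 2 := by
    calc m₀ ^ p = m₀ ^ p * r ^ (-2 : ℝ) * r ^ 2 := by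
          rw [Real.rpow_neg hr.le, Real.rpow_two]; field_simp
      _ ≤ _ := by gcongr
  have h6 := mul_le_mul_of_nonneg_left hQ (Nat.cast_nonneg (α := ℝ) N)
  linarith

/-! ### The logarithmic penalty. -/

/-- Since `log` tends to `-∞` at `0+`, points where `w` is small cannot beat `x₁`, and the maximum
may be sought on a compact set where `w` is bounded below. -/
theorem IsCompact.exists_isMax_add_mul_log {E : Type*} [TopologicalSpace E] {K : Set E}
    (hK : IsCompact K) {G w : E → ℝ} (hG : ContinuousOn G K) (hw : ContinuousOn w K)
    {x₁ : E} (hx₁ : x₁ ∈ K) (hwx₁ : 0 < w x₁) {ε : ℝ} (hε : 0 < ε) :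
    ∃ x ∈ K, 0 < w x ∧
      ∀ y ∈ K, 0 < w y → G y + ε * Real.log (w y) ≤ G x + ε * Real.log (w x) := by
  obtain ⟨B, hB⟩ := hK.bddAbove_image hG
  have hB' : ∀ y ∈ K, G y ≤ B := fun y hy => hB (Set.mem_image_of_mem G hy)
  set F : E → ℝ := fun y => G y + ε * Real.log (w y) with hF
  -- Chosen so that `0 < w y < η` gives `F y ≤ B + (F x₁ - B) = F x₁`.
  set η := min (w x₁) (Real.exp ((F x₁ - B) / ε)) with hη
  have hηpos : 0 < η := lt_min hwx₁ (Real.exp_pos _)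
  set K' := {y ∈ K | η ≤ w y}
  have hx₁K' : x₁ ∈ K' := ⟨hx₁, min_le_left _ _⟩
  obtain ⟨t, ht, hKt⟩ := continuousOn_iff_isClosed.1 hw (Set.Ici η) isClosed_Ici
  have hK' : IsCompact K' := by
    have : K' = K ∩ t := by
      rw [Set.inter_comm K t, ← hKt]
      ext y
      exact ⟨fun h => ⟨h.2, h.1⟩, fun h => ⟨h.2, h.1⟩⟩
    rw [this]
    exact hK.inter_right ht
  have hFK' : ContinuousOn F K' := by
    have hsub : K' ⊆ K := fun y hy => hy.1
    exact (hG.mono hsub).add (continuousOn_const.mul ((hw.mono hsub).log fun y hy =>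
      (hηpos.trans_le hy.2).ne'))
  obtain ⟨x, hx, hmax⟩ := hK'.exists_isMaxOn ⟨x₁, hx₁K'⟩ hFK'
  refine ⟨x, hx.1, hηpos.trans_le hx.2, fun y hy hwy => ?_⟩
  by_cases hyη : η ≤ w y
  · exact hmax ⟨hy, hyη⟩
  · refine le_trans ?_ (hmax hx₁K')
    have h1 : Real.log (w y) ≤ (F x₁ - B) / ε := by
      rw [Real.log_le_iff_le_exp hwy]
      exact (not_le.1 hyη).le.trans (min_le_right _ _)
    rw [le_div_iff₀ hε] at h1
    have := hB' y hy
    change G y + ε * Real.log (w y) ≤ F x₁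
    linarith

/-- With `t = (a - b) / a ≤ 1/2`, this is `-log (1 - t) ≤ t / (1 - t) ≤ t + 2 t²`. -/
theorem log_sub_log_le {a b : ℝ} (ha : 0 < a) (hb : a / 2 ≤ b) :
    Real.log a - Real.log b ≤ (a - b) / a + 2 * ((a - b) / a) ^ 2 := by
  have hb0 : 0 < b := by linarith
  have h1 := Real.one_sub_inv_le_log_of_pos (div_pos hb0 ha)
  rw [Real.log_div hb0.ne' ha.ne', inv_div] at h1
  have h2 : a / b - 1 ≤ (a - b) / a + 2 * ((a - b) / a) ^ 2 := by
    have : (a - b) / a + 2 * ((a - b) / a) ^ 2 - (a / b - 1) =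
        (a - b) ^ 2 * (2 * b - a) / (a ^ 2 * b) := by
      field_simp
      ring
    have h3 : 0 ≤ (a - b) ^ 2 * (2 * b - a) / (a ^ 2 * b) := by
      have : 0 ≤ 2 * b - a := by linarith
      positivity
    linarith
  linarith

/-! ### Local geometry of a `C²` boundary. -/

section geometry

variable {N : ℕ}

/-- Near a boundary point, a `C²` defining function is quantitatively controlled. -/
theorem HasC2Boundary.exists_local_control {Ω : Set (EuclideanSpace ℝ (Fin N))}
    (hΩ : IsOpen Ω) (hb : HasC2Boundary Ω) {x₀ : EuclideanSpace ℝ (Fin N)}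
    (hx₀ : x₀ ∈ frontier Ω) :
    ∃ (ρ : EuclideanSpace ℝ (Fin N) → ℝ) (ν : EuclideanSpace ℝ (Fin N)) (r Λ C : ℝ),
      0 < r ∧ 1 ≤ Λ ∧ 0 ≤ C ∧ 1 ≤ Λ * ‖ν‖ ∧
      (∀ x ∈ Metric.ball x₀ r, x ∈ Ω ↔ ρ x < 0) ∧
      (∀ x ∈ Metric.ball x₀ r, |ρ x| ≤ 1) ∧ ContinuousOn ρ (Metric.ball x₀ r) ∧
      (∀ x ∈ Metric.ball x₀ r, ∀ y ∈ Metric.ball x₀ r, |ρ y - ρ x| ≤ Λ * ‖y - x‖) ∧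
      (∀ x ∈ Metric.ball x₀ r, ∀ y ∈ Metric.ball x₀ r,
        |ρ y - ρ x - fderiv ℝ ρ x (y - x)| ≤ C * ‖y - x‖ ^ 2) ∧
      (∀ x ∈ Metric.ball x₀ r, ∀ (b : ℝ) (z : EuclideanSpace ℝ (Fin N)), 0 ≤ b →
        x + (b • ν + z) ∈ Metric.ball x₀ r →
        ρ x + (b / 2 - Λ * ‖z‖) ≤ ρ (x + (b • ν + z))) ∧ ρ x₀ = 0 := by
  obtain ⟨U, ρ, hU, hxU, hρ, hD, hΩU⟩ := hb x₀ hx₀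
  have hρ₀ : ContDiffAt ℝ 2 ρ x₀ := hρ.contDiffAt (hU.mem_nhds hxU)
  have hmem : ∀ x ∈ U, x ∈ Ω ↔ ρ x < 0 := fun x hx =>
    ⟨fun h => (hΩU.subset ⟨h, hx⟩).2, fun h => (hΩU.superset ⟨hx, h⟩).1⟩
  have hzero : ρ x₀ = 0 := by
    refine le_antisymm ?_ ?_
    · have hne : (𝓝[Ω] x₀).NeBot := mem_closure_iff_nhdsWithin_neBot.1 hx₀.1
      have htend : Tendsto ρ (𝓝[Ω] x₀) (𝓝 (ρ x₀)) :=
        hρ₀.continuousAt.tendsto.mono_left nhdsWithin_le_nhds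
      refine le_of_tendsto htend ?_
      filter_upwards [self_mem_nhdsWithin, nhdsWithin_le_nhds (hU.mem_nhds hxU)] with y hy hyU
        using ((hmem y hyU).1 hy).le
    · rw [hΩ.frontier_eq] at hx₀
      exact not_lt.1 fun h => hx₀.2 ((hmem x₀ hxU).2 h)
  set D := fderiv ℝ ρ x₀ with hDdef
  obtain ⟨v, hv⟩ : ∃ v, D v ≠ 0 := by
    by_contra! h
    exact hD (ContinuousLinearMap.ext h)
  set ν := (D v)⁻¹ • v with hν
  have hDν : D ν = 1 := by simp [hν, hv]
  -- With linearization error at most `κ`, moving by `b • ν` loses at most half of the increase `b *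
  -- D ν = b`.
  set κ := 1 / (2 * (‖ν‖ + 1)) with hκ
  have hκpos : 0 < κ := by positivity
  have hκν : κ * (‖ν‖ + 1) = 1 / 2 := by rw [hκ]; field_simp
  have hκ1 : κ ≤ 1 := by nlinarith [norm_nonneg ν]
  have hstrict := hρ₀.hasStrictFDerivAt (by norm_num)
  obtain ⟨t, ht, happrox⟩ : ∃ t ∈ 𝓝 x₀, ApproximatesLinearOn ρ D t ⟨κ, hκpos.le⟩ :=
    hstrict.approximates_deriv_on_nhds (Or.inr hκpos)
  obtain ⟨r₁, hr₁, C, hC, hT⟩ := hρ₀.exists_abs_sub_sub_fderiv_le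
  obtain ⟨r₂, hr₂, hsub⟩ := Metric.mem_nhds_iff.1 (Filter.inter_mem ht (hU.mem_nhds hxU))
  set Λ := ‖D‖ + 1 with hΛ
  have hΛ1 : 1 ≤ Λ := by linarith [norm_nonneg D]
  have hΛpos : 0 < Λ := by linarith
  -- The bound `1 / Λ` gives `|ρ| ≤ 1`, which later makes `log (-ρ)` nonpositive.
  set r := min (min r₁ r₂) (1 / Λ) with hr
  have hrpos : 0 < r := by positivity
  have hrr₁ : Metric.ball x₀ r ⊆ Metric.ball x₀ r₁ :=
    Metric.ball_subset_ball ((min_le_left _ _).trans (min_le_left _ _))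
  have hrr₂ : Metric.ball x₀ r ⊆ Metric.ball x₀ r₂ :=
    Metric.ball_subset_ball ((min_le_left _ _).trans (min_le_right _ _))
  have happ : ∀ x ∈ Metric.ball x₀ r, ∀ y ∈ Metric.ball x₀ r,
      |ρ y - ρ x - D (y - x)| ≤ κ * ‖y - x‖ := fun x hx y hy =>
    happrox y (hsub (hrr₂ hy)).1 x (hsub (hrr₂ hx)).1
  have hDle : ∀ z, |D z| ≤ ‖D‖ * ‖z‖ := D.le_opNorm
  have hLip : ∀ x ∈ Metric.ball x₀ r, ∀ y ∈ Metric.ball x₀ r, |ρ y - ρ x| ≤ Λ * ‖y - x‖ := by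
    intro x hx y hy
    have h1 := happ x hx y hy
    have h2 := abs_add_le (ρ y - ρ x - D (y - x)) (D (y - x))
    rw [sub_add_cancel] at h2
    have h3 := hDle (y - x)
    have h4 := mul_le_mul_of_nonneg_right hκ1 (norm_nonneg (y - x))
    rw [hΛ]
    linarith
  refine ⟨ρ, ν, r, Λ, C, hrpos, hΛ1, hC, ?_, fun x hx => hmem x (hsub (hrr₂ hx)).2, ?_,
    hρ.continuousOn.mono fun x hx => (hsub (hrr₂ hx)).2, hLip,
    fun x hx y hy => hT x (hrr₁ hx) y (hrr₁ hy), ?_, hzero⟩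
  · have h1 := hDle ν
    rw [hDν, abs_one] at h1
    have := norm_nonneg ν
    rw [hΛ]
    linarith
  · intro x hx
    have h1 := hLip x₀ (Metric.mem_ball_self hrpos) x hx
    rw [hzero, sub_zero] at h1
    have h2 : ‖x - x₀‖ ≤ 1 / Λ := by
      rw [← dist_eq_norm]
      exact (Metric.mem_ball.1 hx).le.trans (min_le_right _ _)
    calc _ ≤ _ := h1
      _ ≤ Λ * (1 / Λ) := by gcongr
      _ = 1 := by field_simp
  · intro x hx b z hb0 hy
    have h1 := happ x hx _ hy
    rw [add_sub_cancel_left, map_add, map_smul, hDν, smul_eq_mul, mul_one] at h1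
    have h2 := (abs_le.1 (hDle z)).1
    have h3 : ‖b • ν + z‖ ≤ b * ‖ν‖ + ‖z‖ := by
      refine (norm_add_le _ _).trans ?_
      rw [norm_smul, Real.norm_eq_abs, abs_of_nonneg hb0]
    have h4 := mul_le_mul_of_nonneg_left h3 hκpos.le
    have h5 := (abs_le.1 h1).1
    have h6 := mul_le_mul_of_nonneg_right hκ1 (norm_nonneg z)
    have h7 : κ * (b * ‖ν‖) ≤ b / 2 := by
      have : κ * ‖ν‖ ≤ 1 / 2 := by linarith
      nlinarith
    rw [hΛ]
    linarith

end geometry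

/-! ### Excluding interior and boundary maxima. -/

section main

variable {N : ℕ} {σ p : ℝ} {Ω : Set (EuclideanSpace ℝ (Fin N))}
  {g h u : EuclideanSpace ℝ (Fin N) → ℝ}

theorem IsSolution.ae_exterior_nonpos {f : EuclideanSpace ℝ (Fin N) → ℝ}
    (hu : IsSolution σ p Ω f g h u) (hh : ∀ᵐ x ∂(volume.restrict (closure Ω)ᶜ), h x ≤ 0) :
    ∀ᵐ y, y ∉ closure Ω → u y ≤ 0 := by
  have := (ae_restrict_iff' (s := (closure Ω)ᶜ) isClosed_closure.measurableSet.compl).1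
    (hu.exterior.and hh)
  filter_upwards [this] with y hy hyΩ
  have := hy hyΩ
  exact this.1.trans_le this.2

variable [NeZero N]

theorem IsSolution.not_exists_interior_max (hσ : σ ∈ Set.Ioo (0 : ℝ) 1) (hp : 1 ≤ p)
    (hσp : 1 ≤ σ * p) (hΩ : IsBoundedC2Domain Ω) (hu : IsSolution σ p Ω (fun _ => 0) g h u)
    (hh : ∀ᵐ x ∂(volume.restrict (closure Ω)ᶜ), h x ≤ 0) {x : EuclideanSpace ℝ (Fin N)}
    (hx : x ∈ Ω) (hmax : ∀ y ∈ closure Ω, u y ≤ u x) (hpos : 0 < u x) : False := by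
  obtain ⟨r', hr', hball⟩ := Metric.isOpen_iff.1 hΩ.isOpen x hx
  obtain ⟨R, hR, hRball⟩ := hΩ.isBounded.closure.subset_ball_lt 0 0
  set r := min r' 1 with hr
  have hrpos : 0 < r := by positivity
  have hr1 : r ≤ 1 := min_le_right _ _
  -- The vector `r • n` has length `R + ‖x‖ + 2`, so the ball of radius `r ≤ 1` about `x + r • n`
  -- misses `closure Ω`.
  obtain ⟨n, hn⟩ := exists_norm_eq (EuclideanSpace ℝ (Fin N))
    (by positivity : 0 ≤ (R + ‖x‖ + 2) / r)
  have hn2 : 2 ≤ ‖n‖ := by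
    rw [hn, le_div_iff₀ hrpos]
    linarith [norm_nonneg x]
  obtain ⟨η, hη, hne⟩ := exists_threshold_equation_ne_zero hσ hp hσp hn2 hpos
  have hext := hu.ae_exterior_nonpos hh
  refine hne u x 0 r 0 hrpos hr1 (by simpa using hη.le) hu.memLp_top
    (hu.contDiffOn.contDiffAt (hΩ.isOpen.mem_nhds hx)) ?_ ?_ ?_ (hu.equation x hx)
  · intro y hy
    simpa using hmax y (subset_closure (hball (Metric.ball_subset_ball (min_le_left _ _) hy)))
  · filter_upwards [hext] with y hy
    by_cases hyΩ : y ∈ closure Ω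
    · linarith [hmax y hyΩ]
    · linarith [hy hyΩ]
  · filter_upwards [hext] with y hy hyb
    have hyΩ : y ∉ closure Ω := fun hyc => by
      have h1 : ‖y‖ < R := by simpa using hRball hyc
      have h2 : ‖y - (x + r • n)‖ < r := by simpa [dist_eq_norm] using hyb
      have h3 : ‖r • n‖ = R + ‖x‖ + 2 := by
        rw [norm_smul, hn, Real.norm_eq_abs, abs_of_pos hrpos]
        field_simp
      have h4 : ‖r • n‖ ≤ ‖y‖ + ‖x‖ + ‖y - (x + r • n)‖ := by
        calc ‖r • n‖ = ‖y - x - (y - (x + r • n))‖ := by congr 1; abel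
          _ ≤ ‖y - x‖ + ‖y - (x + r • n)‖ := norm_sub_le _ _
          _ ≤ _ := by gcongr; exact norm_sub_le _ _
      linarith
    linarith [hy hyΩ]

theorem IsSolution.not_exists_boundary_max (hσ : σ ∈ Set.Ioo (0 : ℝ) 1) (hp : 1 ≤ p)
    (hσp : 1 ≤ σ * p) (hΩ : IsBoundedC2Domain Ω) (hu : IsSolution σ p Ω (fun _ => 0) g h u)
    (hh : ∀ᵐ x ∂(volume.restrict (closure Ω)ᶜ), h x ≤ 0) {x₀ : EuclideanSpace ℝ (Fin N)}
    (hx₀ : x₀ ∈ frontier Ω) (hmax : ∀ y ∈ closure Ω, u y ≤ u x₀) (hpos : 0 < u x₀) : False := by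
  obtain ⟨ρ, ν, r₀, Λ, C, hr₀, hΛ1, hC, hΛν, hmem, hρ1, hρc, hLip, hT, hgrow, hρ0⟩ :=
    hΩ.c2_boundary.exists_local_control hΩ.isOpen hx₀
  set M := u x₀
  have hΛpos : 0 < Λ := by linarith
  -- With `Λ * r = w / 2` below, a shift by `r • e` raises `ρ` by at least `4 * Λ * r = 2 * w`, and
  -- the ball radius costs at most `w / 2`; hence `ρ > 0` on the shifted ball.
  set e := (8 * Λ) • ν with he
  have hen : ‖e‖ = 8 * (Λ * ‖ν‖) := by
    rw [he, norm_smul, Real.norm_eq_abs, abs_of_pos (by positivity)]; ring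
  obtain ⟨η, hη, hne⟩ := exists_threshold_equation_ne_zero hσ hp hσp
    (by rw [hen]; linarith : 2 ≤ ‖e‖) (half_pos hpos)
  have hext := hu.ae_exterior_nonpos hh
  set R := r₀ / 2 with hR
  have hRpos : 0 < R := half_pos hr₀
  have hRsub : Metric.closedBall x₀ R ⊆ Metric.ball x₀ r₀ :=
    Metric.closedBall_subset_ball (half_lt_self hr₀)
  -- In turn: near-maximality at `x`, the drop `M / 2`, room for both balls in the chart, and the
  -- share of `Q * r ^ 2` due to `|· - x₀|²`.
  obtain ⟨d, hd, hdη, hdM, hdR, hdΛ⟩ : ∃ d > 0, d ^ 2 < η ∧ d ^ 2 < M / 2 ∧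
      (‖e‖ + 2) * d < R ∧ Λ ^ 2 * d ^ 2 < η / 2 := by
    have t : ∀ k : ℝ → ℝ, Continuous k → ∀ a, k 0 < a → ∀ᶠ d in 𝓝[>] (0 : ℝ), k d < a :=
      fun k hk a ha => ((hk.tendsto 0).mono_left nhdsWithin_le_nhds).eventually_lt_const ha
    obtain ⟨d, hd⟩ := (eventually_mem_nhdsWithin.and
      ((t (fun d => d ^ 2) (by fun_prop) η (by simpa using hη)).and
      ((t (fun d => d ^ 2) (by fun_prop) (M / 2) (by simpa using hpos)).and
      ((t (fun d => (‖e‖ + 2) * d) (by fun_prop) R (by simpa using hRpos)).and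
      (t (fun d => Λ ^ 2 * d ^ 2) (by fun_prop) (η / 2) (by simpa using hη)))))).exists
    exact ⟨d, hd⟩
  have hd2 : 0 < d ^ 2 := by positivity
  -- a point of `Ω` near `x₀` at which `u` is almost maximal
  obtain ⟨x₁, hx₁Ω, hx₁b, hx₁⟩ : ∃ x₁ ∈ Ω, x₁ ∈ Metric.closedBall x₀ R ∧
      M - d ^ 2 / 2 < u x₁ - ‖x₁ - x₀‖ ^ 2 := by
    have hne : (𝓝[Ω] x₀).NeBot := mem_closure_iff_nhdsWithin_neBot.1 hx₀.1
    have hc : ContinuousWithinAt (fun y => u y - ‖y - x₀‖ ^ 2) Ω x₀ := by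
      refine ((hu.continuousOn x₀ hx₀.1).mono subset_closure).sub ?_
      exact (by fun_prop : Continuous fun y : EuclideanSpace ℝ (Fin N) =>
        ‖y - x₀‖ ^ 2).continuousWithinAt
    have hlt : M - d ^ 2 / 2 < u x₀ - ‖x₀ - x₀‖ ^ 2 := by
      simp only [sub_self, norm_zero]
      linarith
    have hnear : ∀ᶠ y in 𝓝[Ω] x₀, y ∈ Metric.closedBall x₀ R :=
      nhdsWithin_le_nhds (Metric.closedBall_mem_nhds x₀ hRpos)
    obtain ⟨x₁, h⟩ := ((eventually_mem_nhdsWithin (a := x₀) (s := Ω)).and (hnear.and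
      (hc.eventually_const_lt hlt))).exists
    exact ⟨x₁, h⟩
  have hρx₁ : ρ x₁ < 0 := (hmem x₁ (hRsub hx₁b)).1 hx₁Ω
  -- Chosen after `x₁`, so that the penalty there is negligible; the second bound controls the
  -- logarithmic share of `Q * r ^ 2`.
  obtain ⟨ε, hε, hε1, hε2⟩ : ∃ ε > 0, ε * |Real.log (-ρ x₁)| < d ^ 2 / 2 ∧
      ε * (C + 2 * Λ ^ 2) < η / 2 := by
    have t : ∀ b a : ℝ, 0 < a → ∀ᶠ ε in 𝓝[>] (0 : ℝ), ε * b < a := fun b a ha => by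
      have : Continuous fun ε : ℝ => ε * b := by fun_prop
      exact ((this.tendsto 0).mono_left nhdsWithin_le_nhds).eventually_lt_const (by simpa using ha)
    obtain ⟨ε, h⟩ := (eventually_mem_nhdsWithin.and
      ((t |Real.log (-ρ x₁)| (d ^ 2 / 2) (by positivity)).and
        (t (C + 2 * Λ ^ 2) (η / 2) (by positivity)))).exists
    exact ⟨ε, h⟩
  -- the penalized maximum point
  have hK : IsCompact (closure Ω ∩ Metric.closedBall x₀ R) :=
    (isCompact_closedBall x₀ R).inter_left isClosed_closure
  have hGc : ContinuousOn (fun y => u y - ‖y - x₀‖ ^ 2) (closure Ω ∩ Metric.closedBall x₀ R) :=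
    (hu.continuousOn.mono Set.inter_subset_left).sub (by fun_prop)
  have hwc : ContinuousOn (fun y => -ρ y) (closure Ω ∩ Metric.closedBall x₀ R) :=
    (hρc.mono (Set.inter_subset_right.trans hRsub)).neg
  obtain ⟨x, ⟨hxcl, hxR⟩, hwx, hxmax⟩ := hK.exists_isMax_add_mul_log hGc hwc
    ⟨subset_closure hx₁Ω, hx₁b⟩ (neg_pos.2 hρx₁) hε
  have hxb : x ∈ Metric.ball x₀ r₀ := hRsub hxR
  have hxΩ : x ∈ Ω := (hmem x hxb).2 (by linarith)
  set w := -ρ x with hw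
  have hw1 : w ≤ 1 := (neg_le_abs _).trans (hρ1 x hxb)
  have hFx : M - d ^ 2 ≤ u x - ‖x - x₀‖ ^ 2 := by
    have h1 := hxmax x₁ ⟨subset_closure hx₁Ω, hx₁b⟩ (neg_pos.2 hρx₁)
    have h2 : ε * Real.log w ≤ 0 :=
      mul_nonpos_of_nonneg_of_nonpos hε.le (Real.log_nonpos hwx.le hw1)
    have h3 : -(ε * |Real.log (-ρ x₁)|) ≤ ε * Real.log (-ρ x₁) := by
      rw [← mul_neg]
      exact mul_le_mul_of_nonneg_left (neg_abs_le _) hε.le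
    linarith
  have huxM := hmax x hxcl
  have hxd : ‖x - x₀‖ ≤ d := by
    refine abs_le_of_sq_le_sq' ?_ hd.le |>.2
    linarith
  have hux : M - d ^ 2 ≤ u x := by linarith [sq_nonneg ‖x - x₀‖]
  have hwd : w ≤ Λ * d := by
    have h1 := hLip x₀ (Metric.mem_ball_self hr₀) x hxb
    rw [hρ0, sub_zero] at h1
    calc w ≤ |ρ x| := neg_le_abs _
      _ ≤ Λ * ‖x - x₀‖ := h1
      _ ≤ Λ * d := by gcongr
  -- By the Lipschitz bound, `-ρ ≥ w / 2` on this ball, as `log_sub_log_le` requires.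
  set r := w / (2 * Λ) with hr
  have hrpos : 0 < r := by positivity
  have hrw : Λ * r = w / 2 := by rw [hr]; field_simp
  have hrd : r ≤ d / 2 := by
    rw [hr, div_le_iff₀ (by positivity)]
    linarith
  have hr1w : r ≤ w := by
    rw [hr, div_le_iff₀ (by positivity)]
    nlinarith
  have hr1 : r ≤ 1 := hr1w.trans hw1
  have hed : 0 ≤ ‖e‖ * d := by positivity
  set Q := ε * (C / w + 2 * (Λ / w) ^ 2) + 1 with hQ
  set l : EuclideanSpace ℝ (Fin N) →L[ℝ] ℝ :=
    (ε / w) • fderiv ℝ ρ x + (2 : ℝ) • innerSL ℝ (x - x₀) with hl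
  refine hne u x l r Q hrpos hr1 ?_ hu.memLp_top
    (hu.contDiffOn.contDiffAt (hΩ.isOpen.mem_nhds hxΩ)) ?_ ?_ ?_ (hu.equation x hxΩ)
  · have hQ0 : 0 ≤ Q := by positivity
    have hw2 : w ^ 2 ≤ Λ ^ 2 * d ^ 2 := by
      rw [← mul_pow]; gcongr
    -- The powers of `w` in the denominators cancel, so the bound does not degenerate as `w → 0`.
    calc Q * r ^ 2 ≤ Q * w ^ 2 := by gcongr
      _ = ε * (C * w + 2 * Λ ^ 2) + w ^ 2 := by rw [hQ]; field_simp
      _ ≤ ε * (C * 1 + 2 * Λ ^ 2) + w ^ 2 := by gcongr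
      _ ≤ η := by rw [mul_one]; linarith
  · intro y hy
    have hyr : ‖y - x‖ < r := by rwa [← dist_eq_norm]
    have hyR : y ∈ Metric.closedBall x₀ R := by
      rw [Metric.mem_closedBall, dist_eq_norm]
      have : ‖y - x₀‖ ≤ ‖y - x‖ + ‖x - x₀‖ := norm_sub_le_norm_sub_add_norm_sub _ _ _
      linarith
    have hyb := hRsub hyR
    have hLy := hLip x hxb y hyb
    have hΛy : Λ * ‖y - x‖ ≤ w / 2 := by rw [← hrw]; gcongr
    have hwy : w / 2 ≤ -ρ y := by linarith [(abs_le.1 hLy).2]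
    have hyΩ : y ∈ Ω := (hmem y hyb).2 (by linarith)
    have hmaxy := hxmax y ⟨subset_closure hyΩ, hyR⟩ (by linarith)
    have hlog := log_sub_log_le hwx hwy
    have hs1 : (w - -ρ y) / w ≤ (fderiv ℝ ρ x (y - x) + C * ‖y - x‖ ^ 2) / w := by
      gcongr
      linarith [(abs_le.1 (hT x hxb y hyb)).2]
    have hs2 : ((w - -ρ y) / w) ^ 2 ≤ (Λ / w) ^ 2 * ‖y - x‖ ^ 2 := by
      rw [← mul_pow, ← sq_abs, abs_div, abs_of_pos hwx, div_mul_eq_mul_div]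
      gcongr
      rwa [show w - -ρ y = ρ y - ρ x by rw [hw]; ring]
    have hlog' : ε * (Real.log w - Real.log (-ρ y)) ≤
        ε * ((fderiv ℝ ρ x (y - x) + C * ‖y - x‖ ^ 2) / w
          + 2 * ((Λ / w) ^ 2 * ‖y - x‖ ^ 2)) := by
      gcongr
      linarith
    have hsq : ‖y - x₀‖ ^ 2 =
        ‖x - x₀‖ ^ 2 + 2 * inner ℝ (x - x₀) (y - x) + ‖y - x‖ ^ 2 := by
      rw [← norm_add_sq_real, sub_add_sub_cancel']
    have hly : l (y - x) = ε / w * fderiv ℝ ρ x (y - x) + 2 * inner ℝ (x - x₀) (y - x) := by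
      simp [hl, inner_sub_left]
    calc u y ≤ u x + ε * (Real.log w - Real.log (-ρ y)) + (‖y - x₀‖ ^ 2 - ‖x - x₀‖ ^ 2) := by
          linarith
      _ ≤ u x + ε * ((fderiv ℝ ρ x (y - x) + C * ‖y - x‖ ^ 2) / w
          + 2 * ((Λ / w) ^ 2 * ‖y - x‖ ^ 2)) + (‖y - x₀‖ ^ 2 - ‖x - x₀‖ ^ 2) := by linarith
      _ = _ := by rw [hly, hsq, hQ]; ring
  · filter_upwards [hext] with y hy
    by_cases hyΩ : y ∈ closure Ω
    · linarith [hmax y hyΩ]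
    · linarith [hy hyΩ]
  · have hmaps : ∀ y ∈ Metric.ball (x + r • e) r, y ∈ Metric.ball x₀ r₀ ∧ 0 < ρ y := by
      intro y hyb
      set z := y - (x + r • e) with hz
      have hzr : ‖z‖ < r := by rwa [← dist_eq_norm]
      have hyz : y = x + ((r * (8 * Λ)) • ν + z) := by
        rw [hz, mul_smul, ← he]; abel
      have hyb₀ : y ∈ Metric.ball x₀ r₀ := by
        rw [Metric.mem_ball, dist_eq_norm]
        have h1 : ‖y - x₀‖ ≤ ‖x - x₀‖ + r * ‖e‖ + ‖z‖ := by
          calc ‖y - x₀‖ = ‖(x - x₀) + r • e + z‖ := by rw [hz]; congr 1; abel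
            _ ≤ ‖x - x₀‖ + ‖r • e‖ + ‖z‖ := norm_add₃_le
            _ = _ := by rw [norm_smul, Real.norm_eq_abs, abs_of_pos hrpos]
        have h2 : r * ‖e‖ ≤ d / 2 * ‖e‖ := by gcongr
        linarith
      refine ⟨hyb₀, ?_⟩
      have hg := hgrow x hxb (r * (8 * Λ)) z (by positivity) (hyz ▸ hyb₀)
      rw [← hyz] at hg
      have h3 : Λ * ‖z‖ ≤ Λ * r := by gcongr
      linarith
    filter_upwards [hext] with y hy hyb
    have hyΩ : y ∉ closure Ω := by
      have hdisj : Disjoint (Metric.ball (x + r • e) r) Ω := Set.disjoint_left.2 fun z hz hzΩ => by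
        have := hmaps z hz
        exact lt_asymm this.2 ((hmem z this.1).1 hzΩ)
      exact Set.disjoint_left.1 (hdisj.closure_right Metric.isOpen_ball) hyb
    linarith [hy hyΩ]

end main

theorem theorem1p3 (N : ℕ) (σ p : ℝ) (hσ : σ ∈ Set.Ioo (0 : ℝ) 1) (hp : 1 ≤ p)
    (hσp : 1 ≤ σ * p)
    (Ω : Set (EuclideanSpace ℝ (Fin N))) (hΩ : IsBoundedC2Domain Ω)
    (g h : EuclideanSpace ℝ (Fin N) → ℝ)
    (hg : ContinuousOn g (frontier Ω))
    (hg_pos : ¬ ∀ x ∈ frontier Ω, g x ≤ 0)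
    (hh : MemLp h ⊤ (volume.restrict (closure Ω)ᶜ))
    (hh_nonpos : ∀ᵐ x ∂(volume.restrict (closure Ω)ᶜ), h x ≤ 0) :
    ¬ ∃ u : EuclideanSpace ℝ (Fin N) → ℝ, IsSolution σ p Ω (fun _ => 0) g h u := by
  rintro ⟨u, hu⟩
  push Not at hg_pos
  obtain ⟨b, hb, hgb⟩ := hg_pos
  have hN : NeZero N := by
    refine ⟨?_⟩
    rintro rfl
    -- In dimension zero the frontier is empty, contradicting the existence of `b`.
    have : Ω = Set.univ := Subsingleton.eq_univ_of_nonempty hΩ.isConnected.nonempty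
    simp [this] at hb
  have hcomp : IsCompact (closure Ω) := hΩ.isBounded.isCompact_closure
  obtain ⟨x, hx, hmax⟩ := hcomp.exists_isMaxOn ⟨b, hb.1⟩ hu.continuousOn
  have hpos : 0 < u x := by
    have h1 : u b ≤ u x := hmax hb.1
    rw [hu.boundary b hb] at h1
    linarith
  by_cases hxΩ : x ∈ Ω
  · exact hu.not_exists_interior_max hσ hp hσp hΩ hh_nonpos hxΩ (fun y hy => hmax hy) hpos
  · refine hu.not_exists_boundary_max hσ hp hσp hΩ hh_nonpos ?_ (fun y hy => hmax hy) hpos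
    rw [hΩ.isOpen.frontier_eq]
    exact ⟨hx, hxΩ⟩
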